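/- **Theorem.** Let $X\subset\mathbb R^d$ be a finite nonempty set, $n:=|X|$. For a nonempty finite $C\subset\mathbb R^d$ and a finite $B\subset\mathbb R^d$ let $\phi_B(C):=\sum_{x\in B}\min_{c\in C}\|x-c\|_2$ (Euclidean $k$-medians cost). Let $k\ge 1$ and let $C^\star\subset\mathbb R^d$ with $|C^\star|=k$ be optimal, i.e. $\phi_X(C^\star)\le\phi_X(C)$ for all $C\subset\mathbb R^d$ with $|C|=k$. Let $\varepsilon>0$, $\delta>0$, $\alpha\ge1$, and $s:=\lceil 1/\varepsilon^2\rceil$. The procedure *select-sgd* returns $2n^{3+s}$ i.i.d. candidates, each generated as follows. 1. (*guess-ball*) Sample $y\in X$ and $b,m\in\{1,\dots,n\}$ independently and uniformly, let $B$ be the set of the $b$ points of $X$ closest to $y$ (ties broken by any fixed rule), and set $r:=\phi_B(\{y\})/m$. 2. (*projected sgd*) Let $S$ be the closed Euclidean ball of radius $r$ around $y$, let $\Pi_S$ be the orthogonal projection onto $S$, and let $\eta:=2r/\sqrt s$. Perform $s$ iterations of stochastic subgradient descent on $w\mapsto\mathbb E_x\|x-w\|_2$, $x$ uniform on $X$: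 draw $x_1,\dots,x_s$ i.i.d. uniformly from $X$, put $w_1:=y$ and $w_{i+1}:=\Pi_S(w_i-\eta\, g_i)$, where $g_i=g(x_i,w_i)$ is a subgradient of $w\mapsto\|x_i-w\|_2$ at $w_i$ (a fixed but arbitrary selection $g$). The candidate is $\bar w:=\frac1s\sum_{i=1}^s w_i$. The greedy algorithm starts from a nonempty finite $C_0\subset\mathbb R^d$. In each round $i=1,2,\dots,t$ it draws a fresh set $Y_i$ of candidates by *select-sgd* and sets $C_i:=C_{i-1}\cup\{c_i\}$, where $c_i\in Y_i$ is any minimizer of $c\mapsto\phi_X(C_{i-1}\cup\{c\})$ over $Y_i$ (ties broken by any, possibly randomized, rule that depends on $i$, $C_{i-1}$ and $Y_i$). Suppose $\phi_X(C_0)\le\alpha(1+16\varepsilon)\,\phi_X(C^\star)$ and $$t\;\ge\;4k\ln\frac{\alpha-1}{\varepsilon}+8\ln\frac1\delta$$ (for $\alpha=1$, where $\ln 0=-\infty$, this is no restriction on $t$). Then, with probability at least $1-\delta$, $$\phi_X(C_t)\;\le\;(1+\varepsilon)(1+16\varepsilon)\,\phi_X(C^\star).$$ -/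

import Mathlib

open scoped InnerProductSpace

noncomputable section

namespace EuclideanKMedians

variable {E : Type*} [NormedAddCommGroup E] [InnerProductSpace ℝ E]

/-- The `k`-medians cost `φ_X(C) = ∑_{x ∈ X} min_{c ∈ C} ‖x - c‖` of a nonempty finite set `C` of
centers. -/
def cost (X C : Finset E) : ℝ :=
  ∑ x ∈ X, Metric.infDist x (C : Set E)

/-- `C` is an optimal solution with exactly `k` centers (among all points of the space). -/
def IsOptimal (X : Finset E) (k : ℕ) (C : Finset E) : Prop :=
  C.card = k ∧ ∀ C' : Finset E, C'.card = k → cost X C ≤ cost X C'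

/-- `B` consists of the `b` points of `X` closest to `y` (ties broken in some way). -/
def IsClosest (X : Finset E) (y : E) (b : ℕ) (B : Finset E) : Prop :=
  B ⊆ X ∧ B.card = b ∧ ∀ u ∈ B, ∀ v ∈ X, v ∉ B → dist u y ≤ dist v y

/-- `near y b` is a choice of the `b` points of `X` closest to `y`, for `y ∈ X` and
`b ∈ {1, …, |X|}`. -/
def IsClosestRule (X : Finset E) (near : E → ℕ → Finset E) : Prop :=
  ∀ y ∈ X, ∀ b ∈ Finset.Icc 1 X.card, IsClosest X y b (near y b)

/-- `g` is a subgradient of `f` at `w`. -/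
def IsSubgradient (f : E → ℝ) (w g : E) : Prop :=
  ∀ v : E, f w + ⟪g, v - w⟫_ℝ ≤ f v

/-- `grad x w` is a subgradient at `w` of `w ↦ ‖x - w‖`, for every `x ∈ X`. -/
def IsSubgradientOracle (X : Finset E) (grad : E → E → E) : Prop :=
  ∀ x ∈ X, ∀ w : E, IsSubgradient (fun v => ‖x - v‖) w (grad x w)

/-- Orthogonal projection onto `S`: the point of `S` nearest to `z`. -/
def proj (S : Set E) (z : E) : E :=
  Classical.epsilon fun p => p ∈ S ∧ ∀ q ∈ S, dist z p ≤ dist z q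

/-- The iterates of projected stochastic (sub)gradient descent started from `w`, with constraint
set `S` and step size `η`, along the data points in the list: one iterate `w_i` for each data point
`x_i`, where `w_1 = w` and `w_{i+1} = Π_S (w_i - η • grad x_i w_i)`. -/
def sgdIterates (grad : E → E → E) (S : Set E) (η : ℝ) : E → List E → List E
  | _, [] => []
  | w, x :: xs => w :: sgdIterates grad S η (proj S (w - η • grad x w)) xs

/-- Unweighted average of a list of points. -/
def average (l : List E) : E :=
  (l.length : ℝ)⁻¹ • l.sum

/-- `N` independent samples from `p`. -/
def iidSamples {α : Type*} (p : PMF α) : ℕ → PMF (List α)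
  | 0 => PMF.pure []
  | N + 1 => p.bind fun a => (iidSamples p N).map fun l => a :: l

/-- The uniform distribution on `[n] = {1, …, n}`, where `n = |X| ≥ 1`. -/
def uniformSize (X : Finset E) (hX : X.Nonempty) : PMF ℕ :=
  PMF.uniformOfFinset (Finset.Icc 1 X.card) (Finset.nonempty_Icc.mpr hX.card_pos)

/-- `guess-ball`: sample `y ∈ X` and `b, m ∈ [n]` uniformly (and independently), let `B` be the `b`
points of `X` closest to `y`, and return `(y, m, B)`. -/
def guessBall (X : Finset E) (hX : X.Nonempty) (near : E → ℕ → Finset E) :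
    PMF (E × ℕ × Finset E) :=
  (PMF.uniformOfFinset X hX).bind fun y =>
    (uniformSize X hX).bind fun b =>
      (uniformSize X hX).map fun m => (y, m, near y b)

/-- Stochastic gradient descent for the objective `w ↦ 𝔼 ‖x - w‖`, with `x` uniform on `X`, started
from `y`, constrained to the ball of radius `r` around `y`, with `s` iterations and step size
`2 r / √s`: the distribution of the average of the iterates. -/
def sgd (X : Finset E) (hX : X.Nonempty) (grad : E → E → E) (y : E) (r : ℝ) (s : ℕ) : PMF E :=
  (iidSamples (PMF.uniformOfFinset X hX) s).map fun xs =>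
    average (sgdIterates grad (Metric.closedBall y r) (2 * r / √s) y xs)

/-- A single candidate of `select-sgd`: take `(y, m, B)` from `guess-ball`, put
`r = φ_B({y}) / m`, and run `s = ⌈1/ε²⌉` iterations of sgd in the ball of radius `r` around `y`. -/
def sgdCandidate (X : Finset E) (hX : X.Nonempty) (near : E → ℕ → Finset E) (grad : E → E → E)
    (ε : ℝ) : PMF E :=
  (guessBall X hX near).bind fun (y, m, B) =>
    sgd X hX grad y (cost B {y} / m) ⌈1 / ε ^ 2⌉₊

/-- `select-sgd`: `2 n ^ (3 + ⌈1/ε²⌉)` independent candidates, where `n = |X|`. -/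
def selectSgd (X : Finset E) (hX : X.Nonempty) (near : E → ℕ → Finset E) (grad : E → E → E)
    (ε : ℝ) : PMF (List E) :=
  iidSamples (sgdCandidate X hX near grad ε) (2 * X.card ^ (3 + ⌈1 / ε ^ 2⌉₊))

open Classical in
/-- A rule by which the greedy algorithm chooses, in round `i` with current centers `C` and
candidates `Y`, the new center: some candidate, possibly chosen at random, that minimizes the
resulting cost exactly (tolerance `τ = 0`). -/
def IsGreedyRule (X : Finset E) (pick : ℕ → Finset E → List E → PMF E) : Prop :=
  ∀ (i : ℕ) (C : Finset E) (Y : List E), Y ≠ [] → ∀ c ∈ (pick i C Y).support,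
    c ∈ Y ∧ ∀ c' ∈ Y, cost X (insert c C) ≤ cost X (insert c' C)

open Classical in
/-- The distribution of the centers `C_t` produced by `t` rounds of the greedy algorithm started
from `C₀`. In each round the candidates are drawn afresh by `select`, which may depend on the
current centers, and the center chosen by `pick` is added. -/
def greedy (select : Finset E → PMF (List E)) (pick : ℕ → Finset E → List E → PMF E)
    (C₀ : Finset E) : ℕ → PMF (Finset E)
  | 0 => PMF.pure C₀
  | i + 1 => (greedy select pick C₀ i).bind fun C =>
      (select C).bind fun Y => (pick (i + 1) C Y).map fun c => insert c C

end EuclideanKMedians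

end

namespace EuclideanKMedians

/-! Put `b = (1 + 16ε) φ_X(C⋆)` and follow the `k`-th power of the positive part of `φ_X(C) - b`. If
the excess is positive, some optimal cluster `A` with center `c` carries at least a `1/k` share of
it (`exists_cluster`). Adding a center `w` with `φ_A(w) ≤ (1 + 16ε) φ_A(c)` then multiplies the
excess by at most `1 - 1/k`, and its `k`-th power by at most `e⁻¹`.

Such a `w` need only be one possible outcome of the sampling (`exists_good_outcome`): start at the
point of `A` nearest to `c`, guess `r` within a constant factor of the mean distance `φ_A(c) / |A|`,
and let every gradient step draw a favorable point of `A`. The outcome has probability at least `n ^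
(-(3 + s))`, so all `2 n ^ (3 + s)` candidates miss it with probability at most `e⁻²`. Centers never
raise the cost, so the expected potential shrinks by `e⁻¹ + e⁻² ≤ e^(-1/4)` per round
(`expect_round_le`), and Markov's inequality finishes. -/

theorem sum_map_sub_const {α : Type*} (l : List α) (f : α → ℝ) (a : ℝ) :
    (l.map fun v => f v - a).sum = (l.map f).sum - l.length * a := by
  induction l with
  | nil => simp
  | cons v l ih =>
    simp only [List.map_cons, List.sum_cons, List.length_cons, ih]
    push_cast
    ring

/-! ### Monotonicity of the cost, and sums over nearest points -/

section Cost

variable {E : Type*} [NormedAddCommGroup E]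

theorem cost_singleton (B : Finset E) (y : E) : cost B {y} = ∑ x ∈ B, dist x y := by
  simp [cost]

theorem cost_nonneg (X C : Finset E) : 0 ≤ cost X C :=
  Finset.sum_nonneg fun _ _ => Metric.infDist_nonneg

/-- Nonemptiness matters: `Metric.infDist` to the empty set is `0`. -/
theorem cost_anti (X : Finset E) {C D : Finset E} (hC : C.Nonempty) (h : C ⊆ D) :
    cost X D ≤ cost X C :=
  Finset.sum_le_sum fun _ _ =>
    Metric.infDist_le_infDist_of_subset (by exact_mod_cast h) (by exact_mod_cast hC)

theorem cost_mono {A B : Finset E} (h : A ⊆ B) (C : Finset E) : cost A C ≤ cost B C :=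
  Finset.sum_le_sum_of_subset_of_nonneg h fun _ _ _ => Metric.infDist_nonneg

/-- The `b` closest points have the least total distance among all sets of `b` points. -/
theorem IsClosest.cost_le {X B D : Finset E} {y : E} {b : ℕ} (hB : IsClosest X y b B)
    (hD : D ⊆ X) (hc : D.card = b) : cost B {y} ≤ cost D {y} := by
  classical
  obtain ⟨-, hcard, hcl⟩ := hB
  rw [cost_singleton, cost_singleton, ← Finset.sum_inter_add_sum_sdiff B D,
    ← Finset.sum_inter_add_sum_sdiff D B, Finset.inter_comm D B]
  have hcomm : (B \ D).card = (D \ B).card := Finset.card_sdiff_comm (hcard.trans hc.symm)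
  gcongr 1
  rcases (D \ B).eq_empty_or_nonempty with h | h
  · rw [h, Finset.card_empty, Finset.card_eq_zero] at hcomm
    rw [h, hcomm]
  -- The distance of the nearest point `v` of `D \ B` separates the two differences, which have
  -- equal size.
  · obtain ⟨v, hv, hmin⟩ := Finset.exists_min_image (D \ B) (fun v => dist v y) h
    rw [Finset.mem_sdiff] at hv
    calc ∑ x ∈ B \ D, dist x y ≤ (B \ D).card • dist v y :=
          Finset.sum_le_card_nsmul _ _ _ fun u hu =>
            hcl u (Finset.mem_sdiff.mp hu).1 v (hD hv.1) hv.2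
      _ = (D \ B).card • dist v y := by rw [hcomm]
      _ ≤ ∑ x ∈ D \ B, dist x y := Finset.card_nsmul_le_sum _ _ _ hmin

/-- For every `A ⊆ X` and `y ∈ A`, some number `b` makes the total distance of the `b` points
closest to `y` comparable to a prescribed value below the total distance of `A`. -/
theorem exists_near_cost_between {X A : Finset E} {near : E → ℕ → Finset E}
    (hnear : IsClosestRule X near) (hA : A ⊆ X) {y : E} (hy : y ∈ A) {T : ℝ} (hT : 0 < T)
    (hTA : T < cost A {y}) :
    ∃ b ∈ Finset.Icc 1 X.card,
      T ≤ cost (near y b) {y} ∧ cost (near y b) {y} ≤ T + cost A {y} := by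
  classical
  have hn : 1 ≤ X.card := Finset.card_pos.mpr ⟨y, hA hy⟩
  have hex : ∃ b, b ∈ Finset.Icc 1 X.card ∧ T ≤ cost (near y b) {y} := by
    refine ⟨X.card, Finset.mem_Icc.mpr ⟨hn, le_rfl⟩, ?_⟩
    obtain ⟨hsub, hcard, -⟩ := hnear y (hA hy) X.card (Finset.mem_Icc.mpr ⟨hn, le_rfl⟩)
    rw [Finset.eq_of_subset_of_card_le hsub hcard.ge]
    exact hTA.le.trans (cost_mono hA _)
  -- Take the least `b` reaching `T`; minimality bounds the overshoot by a single distance.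
  obtain ⟨hb, hTb⟩ := Nat.find_spec hex
  have hmin := fun m => Nat.find_min (m := m) hex
  generalize Nat.find hex = b at hb hTb hmin
  refine ⟨b, hb, hTb, ?_⟩
  have hcl := hnear y (hA hy) b hb
  rw [Finset.mem_Icc] at hb
  obtain hb1 | hb1 := hb.1.eq_or_lt
  · have := hcl.cost_le (D := {y}) (by simpa using hA hy) (by simpa using hb1)
    rw [cost_singleton {y}] at this
    simp only [Finset.sum_singleton, dist_self] at this
    linarith
  · have hb' : b - 1 ∈ Finset.Icc 1 X.card := Finset.mem_Icc.mpr ⟨by omega, by omega⟩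
    have hlt : cost (near y (b - 1)) {y} < T := by
      by_contra! h
      exact hmin (b - 1) (by omega) ⟨hb', h⟩
    obtain ⟨hsub, hcard, -⟩ := hnear y (hA hy) (b - 1) hb'
    -- If `A` lay inside the `b - 1` nearest points, their cost would exceed `T`.
    obtain ⟨a, ha, haB⟩ : ∃ a ∈ A, a ∉ near y (b - 1) := by
      by_contra! h
      exact absurd (cost_mono h {y}) (by linarith)
    -- Ties may keep the nearest sets from being nested, so costs are compared instead of sets.
    have := hcl.cost_le (D := insert a (near y (b - 1)))
      (Finset.insert_subset (hA ha) hsub) (by rw [Finset.card_insert_of_notMem haB]; omega)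
    have hda : dist a y ≤ cost A {y} := by
      rw [cost_singleton]
      exact Finset.single_le_sum (f := fun x => dist x y) (fun _ _ => dist_nonneg) ha
    rw [cost_singleton (insert _ _), Finset.sum_insert haB, ← cost_singleton] at this
    linarith

end Cost

/-! ### Projected subgradient descent and the existence of a good outcome -/

section Geometry

variable {E : Type*} [NormedAddCommGroup E] [InnerProductSpace ℝ E]

theorem IsSubgradient.norm_le_one {x w g : E} (h : IsSubgradient (fun v => ‖x - v‖) w g) :
    ‖g‖ ≤ 1 := by
  -- Along `g` itself the norm grows by at least `‖g‖²`, but by at most `‖g‖`.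
  have h1 := h (w + g)
  simp only [add_sub_cancel_left, real_inner_self_eq_norm_sq] at h1
  have h2 : ‖x - (w + g)‖ ≤ ‖x - w‖ + ‖g‖ := by
    rw [← sub_sub]
    exact norm_sub_le _ _
  by_contra! h3
  nlinarith

theorem proj_spec [CompleteSpace E] {S : Set E} (hne : S.Nonempty) (hcl : IsClosed S)
    (hco : Convex ℝ S) (z : E) : proj S z ∈ S ∧ ∀ q ∈ S, dist z (proj S z) ≤ dist z q := by
  apply Classical.epsilon_spec (p := fun p => p ∈ S ∧ ∀ q ∈ S, dist z p ≤ dist z q)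
  obtain ⟨p, hp, hpz⟩ := exists_norm_eq_iInf_of_complete_convex hne hcl.isComplete hco z
  refine ⟨p, hp, fun q hq => ?_⟩
  rw [dist_eq_norm, dist_eq_norm, hpz]
  exact ciInf_le ⟨0, by rintro _ ⟨w, rfl⟩; exact norm_nonneg _⟩ (⟨q, hq⟩ : S)

/-- Projecting onto a convex set does not increase the distance to its points. -/
theorem norm_proj_sub_le [CompleteSpace E] {S : Set E} (hcl : IsClosed S) (hco : Convex ℝ S)
    (z : E) {c : E} (hc : c ∈ S) : ‖proj S z - c‖ ≤ ‖z - c‖ := by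
  obtain ⟨hp, hmin⟩ := proj_spec ⟨c, hc⟩ hcl hco z
  have : Nonempty S := ⟨⟨c, hc⟩⟩
  have hinf : ‖z - proj S z‖ = ⨅ w : S, ‖z - w‖ := by
    refine le_antisymm (le_ciInf fun w => ?_)
      (ciInf_le ⟨0, by rintro _ ⟨w, rfl⟩; exact norm_nonneg _⟩ (⟨_, hp⟩ : S))
    simpa only [dist_eq_norm] using hmin w w.2
  -- The angle at the projection between `z` and `c` is not acute.
  have hin := (norm_eq_iInf_iff_real_inner_le_zero hco hp).mp hinf c hc
  have hsq := norm_sub_sq_real (z - proj S z) (c - proj S z)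
  rw [sub_sub_sub_cancel_right] at hsq
  rw [norm_sub_rev (proj S z)]
  refine le_of_sq_le_sq ?_ (norm_nonneg _)
  nlinarith [sq_nonneg ‖z - proj S z‖]

theorem length_sgdIterates (grad : E → E → E) (S : Set E) (η : ℝ) (w : E) (xs : List E) :
    (sgdIterates grad S η w xs).length = xs.length := by
  induction xs generalizing w with
  | nil => rfl
  | cons x xs ih => simp [sgdIterates, ih]

theorem mem_of_mem_sgdIterates [CompleteSpace E] {grad : E → E → E} {S : Set E} {η : ℝ} {w : E}
    {xs : List E} (hcl : IsClosed S) (hco : Convex ℝ S) (hw : w ∈ S) :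
    ∀ v ∈ sgdIterates grad S η w xs, v ∈ S := by
  induction xs generalizing w with
  | nil => simp [sgdIterates]
  | cons x xs ih =>
    simpa [sgdIterates, hw] using ih (proj_spec ⟨w, hw⟩ hcl hco _).1

/-- Along suitably chosen data points, projected subgradient descent has small total regret. -/
theorem exists_regret_le [CompleteSpace E] {A : Finset E} (hA : A.Nonempty) {grad : E → E → E}
    (hgrad : IsSubgradientOracle A grad) {S : Set E} (hcl : IsClosed S) (hco : Convex ℝ S)
    {c : E} (hc : c ∈ S) {η : ℝ} (hη : 0 ≤ η) (s : ℕ) (w : E) :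
    ∃ xs : List E, xs.length = s ∧ (∀ x ∈ xs, x ∈ A) ∧
      2 * η * ((sgdIterates grad S η w xs).map fun v => cost A {v} - cost A {c}).sum ≤
        A.card * (‖w - c‖ ^ 2 + s * η ^ 2) := by
  induction s generalizing w with
  | zero => exact ⟨[], rfl, by simp, by simp [sgdIterates]; positivity⟩
  | succ s ih =>
    -- The maximal inner product over `A` is at least the average one, which bounds the regret by
    -- convexity. The choice of `x` may depend on the current iterate.
    obtain ⟨x, hx, hxw⟩ : ∃ x ∈ A, cost A {w} - cost A {c} ≤ A.card * ⟪grad x w, w - c⟫_ℝ := by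
      obtain ⟨x, hx, hmax⟩ :=
        Finset.exists_max_image A (fun x => ⟪grad x w, w - c⟫_ℝ) hA
      refine ⟨x, hx, ?_⟩
      rw [cost_singleton, cost_singleton, ← Finset.sum_sub_distrib, ← nsmul_eq_mul]
      refine Finset.sum_le_card_nsmul _ _ _ fun u hu => le_trans ?_ (hmax u hu)
      have := hgrad u hu w c
      rw [← neg_sub w c, inner_neg_right] at this
      simp only [dist_eq_norm]
      linarith
    obtain ⟨xs, hlen, hxs, hreg⟩ := ih (proj S (w - η • grad x w))
    refine ⟨x :: xs, by simp [hlen], by simpa [hx] using hxs, ?_⟩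
    simp only [sgdIterates, List.map_cons, List.sum_cons]
    have hstep : ‖proj S (w - η • grad x w) - c‖ ^ 2 ≤
        ‖w - c‖ ^ 2 - 2 * η * ⟪grad x w, w - c⟫_ℝ + η ^ 2 := by
      have h1 := norm_proj_sub_le hcl hco (w - η • grad x w) hc
      have h2 := norm_sub_sq_real (w - c) (η • grad x w)
      rw [inner_smul_right, real_inner_comm, norm_smul, Real.norm_of_nonneg hη, mul_pow] at h2
      have h3 : w - η • grad x w - c = w - c - η • grad x w := by abel
      rw [h3] at h1
      have h4 : ‖grad x w‖ ^ 2 ≤ 1 :=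
        pow_le_one₀ (norm_nonneg _) (hgrad x hx w).norm_le_one
      have h5 := pow_le_pow_left₀ (norm_nonneg _) h1 2
      nlinarith [mul_le_mul_of_nonneg_left h4 (sq_nonneg η)]
    have hcard : (0 : ℝ) ≤ A.card := Nat.cast_nonneg _
    have h6 := mul_le_mul_of_nonneg_left hstep hcard
    have h7 := mul_le_mul_of_nonneg_left hxw (mul_nonneg zero_le_two hη)
    push_cast
    nlinarith

/-- Jensen's inequality for the convex function `w ↦ φ_A({w})`. -/
theorem cost_average_mul_le (A : Finset E) {l : List E} (hl : l ≠ []) :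
    l.length * cost A {average l} ≤ (l.map fun v => cost A {v}).sum := by
  have hlen : (0 : ℝ) < l.length := by exact_mod_cast List.length_pos_iff.mpr hl
  have key : ∀ (x : E) (l : List E), ‖(l.length : ℝ) • x - l.sum‖ ≤
      (l.map fun v => dist x v).sum := by
    intro x l
    induction l with
    | nil => simp
    | cons v l ih =>
      have : ((v :: l).length : ℝ) • x - (v :: l).sum =
          (x - v) + ((l.length : ℝ) • x - l.sum) := by
        simp only [List.length_cons, List.sum_cons, Nat.cast_add, Nat.cast_one, add_smul, one_smul]
        abel
      rw [this, List.map_cons, List.sum_cons, dist_eq_norm]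
      exact (norm_add_le _ _).trans (by gcongr)
  have hsum : (l.map fun v => cost A {v}).sum = ∑ x ∈ A, (l.map fun v => dist x v).sum := by
    simp only [cost_singleton]
    induction l with
    | nil => simp
    | cons v l ih =>
      by_cases h : l = []
      · simp [h]
      · rw [List.map_cons, List.sum_cons,
          ih h (by exact_mod_cast List.length_pos_iff.mpr h), ← Finset.sum_add_distrib]
        simp
  rw [hsum, cost_singleton, Finset.mul_sum]
  refine Finset.sum_le_sum fun x _ => le_trans (le_of_eq ?_) (key x l)
  rw [average, dist_eq_norm, ← Real.norm_of_nonneg hlen.le, ← norm_smul, smul_sub, smul_smul,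
    Real.norm_of_nonneg hlen.le, mul_inv_cancel₀ hlen.ne', one_smul]

theorem average_eq_of_forall_eq {l : List E} (hl : l ≠ []) {y : E} (h : ∀ v ∈ l, v = y) :
    average l = y := by
  have hlen : (l.length : ℝ) ≠ 0 := by exact_mod_cast (List.length_pos_iff.mpr hl).ne'
  rw [average, List.eq_replicate_of_mem h, List.sum_replicate, List.length_replicate,
    ← Nat.cast_smul_eq_nsmul ℝ, smul_smul, inv_mul_cancel₀ hlen, one_smul]

/-- For every `A ⊆ X` and every center `c`, some outcome of the sampling yields a
`(1 + 16 ε)`-approximation of the cost of `c` on `A`. -/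
theorem exists_good_outcome [CompleteSpace E] {X A : Finset E} {near : E → ℕ → Finset E}
    (hnear : IsClosestRule X near) {grad : E → E → E} (hgrad : IsSubgradientOracle X grad)
    (hAX : A ⊆ X) (hA : A.Nonempty) (c : E) {ε : ℝ} (hε : 0 < ε) {s : ℕ}
    (hs : 1 / ε ^ 2 ≤ s) :
    ∃ y ∈ X, ∃ b ∈ Finset.Icc 1 X.card, ∃ m ∈ Finset.Icc 1 X.card, ∃ xs : List E,
      xs.length = s ∧ (∀ x ∈ xs, x ∈ X) ∧
      cost A {average (sgdIterates grad (Metric.closedBall y (cost (near y b) {y} / m))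
        (2 * (cost (near y b) {y} / m) / √s) y xs)} ≤ (1 + 16 * ε) * cost A {c} := by
  have hs0 : (0 : ℝ) < s := lt_of_lt_of_le (by positivity) hs
  have hsN : 0 < s := by exact_mod_cast hs0
  have hn : 1 ≤ X.card := Finset.card_pos.mpr (hA.mono hAX)
  have h1n : 1 ∈ Finset.Icc 1 X.card := Finset.mem_Icc.mpr ⟨le_rfl, hn⟩
  obtain ⟨y, hy, hmin⟩ := Finset.exists_min_image A (fun x => dist x c) hA
  by_cases hgood : cost A {y} ≤ (1 + 16 * ε) * cost A {c}
  · refine ⟨y, hAX hy, 1, h1n, 1, h1n, List.replicate s y, by simp, ?_, ?_⟩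
    · intro x hx
      rw [List.eq_of_mem_replicate hx]
      exact hAX hy
    -- With `b = 1` the radius is `0`, so every iterate equals `y`.
    · have h0 : cost (near y 1) {y} = 0 := by
        refine le_antisymm ?_ (cost_nonneg _ _)
        have := (hnear y (hAX hy) 1 h1n).cost_le (D := {y}) (by simpa using hAX hy) (by simp)
        rw [cost_singleton {y}] at this
        simpa using this
      rw [average_eq_of_forall_eq (y := y)]
      · exact hgood
      · rw [← List.length_pos_iff, length_sgdIterates, List.length_replicate]
        exact hsN
      · intro v hv
        have := mem_of_mem_sgdIterates Metric.isClosed_closedBall (convex_closedBall _ _)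
          (Metric.mem_closedBall_self (by simp [h0])) v hv
        simpa [h0] using this
  push Not at hgood
  have ha : (0 : ℝ) < A.card := by exact_mod_cast hA.card_pos
  have hyc : A.card * dist y c ≤ cost A {c} := by
    rw [cost_singleton, ← nsmul_eq_mul]
    exact Finset.card_nsmul_le_sum _ _ _ hmin
  have hAy : cost A {y} ≤ 2 * cost A {c} := by
    calc cost A {y} ≤ ∑ x ∈ A, (dist x c + dist y c) := by
          rw [cost_singleton]
          exact Finset.sum_le_sum fun x _ => dist_triangle_right _ _ _
      _ = cost A {c} + A.card * dist y c := by
          rw [Finset.sum_add_distrib, ← cost_singleton, Finset.sum_const, nsmul_eq_mul]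
      _ ≤ _ := by linarith
  have hc0 : 0 < cost A {c} := by
    refine (cost_nonneg A {c}).lt_of_ne fun h => ?_
    rw [← h] at hgood hAy
    linarith
  -- With `T = φ_A(c)` and `φ_A(y) ≤ 2T`, the cost of the guessed set lies in `[T, 3T]`. Dividing by
  -- `m = |A|` gives a ball containing `c`, of radius at most three mean distances.
  obtain ⟨b, hb, hlow, hup⟩ := exists_near_cost_between hnear hAX hy hc0
    (by nlinarith [mul_pos hε hc0])
  set r := cost (near y b) {y} / A.card with hr
  have hrlow : cost A {c} ≤ A.card * r := by rwa [hr, mul_div_cancel₀ _ ha.ne']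
  have hrup : A.card * r ≤ 3 * cost A {c} := by
    rw [hr, mul_div_cancel₀ _ ha.ne']
    linarith
  have hr0 : 0 < r := pos_of_mul_pos_right (hc0.trans_le hrlow) ha.le
  have hycr : dist y c ≤ r := le_of_mul_le_mul_left (hyc.trans hrlow) ha
  have hsq : 0 < √(s : ℝ) := Real.sqrt_pos.mpr hs0
  have hss : √(s : ℝ) * √(s : ℝ) = s := Real.mul_self_sqrt hs0.le
  set η := 2 * r / √(s : ℝ) with hη
  have hη0 : 0 < η := by positivity
  obtain ⟨xs, hlen, hxs, hreg⟩ := exists_regret_le hA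
    (fun x hx w => hgrad x (hAX hx) w) Metric.isClosed_closedBall (convex_closedBall y r)
    (c := c) (by rwa [Metric.mem_closedBall, dist_comm]) hη0.le s y
  refine ⟨y, hAX hy, b, hb, A.card, Finset.mem_Icc.mpr ⟨hA.card_pos, Finset.card_le_card hAX⟩,
    xs, hlen, fun x hx => hAX (hxs x hx), ?_⟩
  rw [← hr, ← hη]
  set l := sgdIterates grad (Metric.closedBall y r) η y xs with hl
  have hll : l.length = s := by rw [hl, length_sgdIterates, hlen]
  have havg := cost_average_mul_le A (l := l)
    (by rw [← List.length_pos_iff, hll]; exact hsN)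
  have hsub : ((l.map fun v => cost A {v} - cost A {c}).sum) =
      (l.map fun v => cost A {v}).sum - s * cost A {c} := by
    rw [← hll]
    exact sum_map_sub_const l _ _
  rw [hll] at havg
  rw [hsub] at hreg
  have hηs : η * √(s : ℝ) = 2 * r := by rw [hη]; field_simp
  have hys : ‖y - c‖ ^ 2 ≤ r ^ 2 := by
    rw [← dist_eq_norm]
    exact pow_le_pow_left₀ dist_nonneg hycr 2
  have hsη : (s : ℝ) * η ^ 2 = 4 * r ^ 2 := by
    rw [← hss]
    linear_combination (η * √(s : ℝ) + 2 * r) * hηs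
  have hinv : 1 ≤ ε * √(s : ℝ) := by
    have h1 : 1 ≤ ε ^ 2 * s := by
      rw [div_le_iff₀ (by positivity)] at hs
      linarith
    rw [← hss] at h1
    by_contra! h
    nlinarith [mul_pos hε hsq]
  -- with `W` the cost of the average: `2 η s (W - cost A {c}) ≤ 5 |A| r²`
  set W := cost A {average l}
  have h1 : 2 * η * (s * (W - cost A {c})) ≤ A.card * (5 * r ^ 2) := by
    calc 2 * η * (s * (W - cost A {c})) ≤
          2 * η * ((l.map fun v => cost A {v}).sum - s * cost A {c}) := by
          gcongr
          linarith
      _ ≤ _ := hreg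
      _ ≤ _ := by
        rw [hsη]
        gcongr
        linarith
  have h2 : 2 * η * (s * (W - cost A {c})) = r * (4 * (√(s : ℝ) * (W - cost A {c}))) := by
    linear_combination (2 * √(s : ℝ) * (W - cost A {c})) * hηs - 2 * η * (W - cost A {c}) * hss
  have h3 : 4 * (√(s : ℝ) * (W - cost A {c})) ≤ 5 * (A.card * r) := by
    refine le_of_mul_le_mul_left ?_ hr0
    rw [← h2]
    linarith
  -- The left side is at most `(5/4) |A| r ≤ (15/4) φ_A(c)`, and `1 ≤ ε √s`; the constant `16`
  -- leaves slack.
  have h4 : √(s : ℝ) * (W - cost A {c}) ≤ √(s : ℝ) * (16 * ε * cost A {c}) := by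
    nlinarith
  have := le_of_mul_le_mul_left h4 hsq
  linarith

end Geometry

/-! ### Expectations and independent samples for `PMF` -/

section Probability

open scoped ENNReal

variable {α β : Type*}

/-- The expectation of `F` under `p`. -/
noncomputable def expect (p : PMF α) (F : α → ℝ≥0∞) : ℝ≥0∞ :=
  ∑' a, p a * F a

theorem expect_bind (p : PMF α) (f : α → PMF β) (F : β → ℝ≥0∞) :
    expect (p.bind f) F = expect p fun a => expect (f a) F := by
  simp only [expect, PMF.bind_apply, ← ENNReal.tsum_mul_right, ← ENNReal.tsum_mul_left]
  rw [ENNReal.tsum_comm]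
  simp only [mul_assoc]

theorem expect_pure (a : α) (F : α → ℝ≥0∞) : expect (PMF.pure a) F = F a := by
  rw [expect, tsum_eq_single a fun b hb => by simp [PMF.pure_apply_of_ne _ _ hb],
    PMF.pure_apply_self, one_mul]

theorem expect_map (p : PMF α) (f : α → β) (F : β → ℝ≥0∞) :
    expect (p.map f) F = expect p fun a => F (f a) := by
  rw [← PMF.bind_pure_comp, expect_bind]
  simp only [Function.comp_apply, expect_pure]

/-- Restricting to the support lets guarantees on possible outcomes be used, such as the greedy
choice being a minimizer. -/
theorem expect_mono {p : PMF α} {F G : α → ℝ≥0∞} (h : ∀ a ∈ p.support, F a ≤ G a) :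
    expect p F ≤ expect p G := by
  refine ENNReal.tsum_le_tsum fun a => ?_
  by_cases ha : a ∈ p.support
  · gcongr
    exact h a ha
  · simp [(p.apply_eq_zero_iff a).mpr ha]

theorem expect_const (p : PMF α) (c : ℝ≥0∞) : expect p (fun _ => c) = c := by
  rw [expect, ENNReal.tsum_mul_right, p.tsum_coe, one_mul]

theorem expect_add (p : PMF α) (F G : α → ℝ≥0∞) :
    expect p (fun a => F a + G a) = expect p F + expect p G := by
  simp only [expect, mul_add, ENNReal.tsum_add]

theorem expect_mul_left (p : PMF α) (c : ℝ≥0∞) (F : α → ℝ≥0∞) :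
    expect p (fun a => c * F a) = c * expect p F := by
  simp only [expect, ← ENNReal.tsum_mul_left, mul_left_comm]

theorem expect_indicator (p : PMF α) (S : Set α) (c : ℝ≥0∞) :
    expect p (S.indicator fun _ => c) = p.toOuterMeasure S * c := by
  rw [expect, PMF.toOuterMeasure_apply, ← ENNReal.tsum_mul_right]
  refine tsum_congr fun a => ?_
  by_cases ha : a ∈ S <;> simp [ha]

theorem toOuterMeasure_mul_le_expect (p : PMF α) {S : Set α} {F : α → ℝ≥0∞} {c : ℝ≥0∞}
    (h : ∀ a ∈ S, c ≤ F a) : p.toOuterMeasure S * c ≤ expect p F := by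
  rw [← expect_indicator]
  refine expect_mono fun a _ => ?_
  by_cases ha : a ∈ S <;> simp [ha, h]

theorem toOuterMeasure_add_compl (p : PMF α) (S : Set α) :
    p.toOuterMeasure S + p.toOuterMeasure Sᶜ = 1 := by
  rw [PMF.toOuterMeasure_apply, PMF.toOuterMeasure_apply, ← ENNReal.tsum_add, ← p.tsum_coe]
  exact tsum_congr fun a => Set.indicator_self_add_compl_apply S p a

theorem mul_apply_le_bind_apply (p : PMF α) (f : α → PMF β) (a : α) (b : β) :
    p a * f a b ≤ p.bind f b := by
  rw [PMF.bind_apply]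
  exact ENNReal.le_tsum (f := fun a => p a * f a b) a

theorem apply_le_map_apply (p : PMF α) (f : α → β) (a : α) : p a ≤ p.map f (f a) := by
  have := mul_apply_le_bind_apply p (PMF.pure ∘ f) a (f a)
  rwa [PMF.bind_pure_comp, Function.comp_apply, PMF.pure_apply_self, mul_one] at this

theorem pow_le_iidSamples_apply (p : PMF α) {c : ℝ≥0∞} (l : List α) (h : ∀ a ∈ l, c ≤ p a) :
    c ^ l.length ≤ iidSamples p l.length l := by
  induction l with
  | nil => simp [iidSamples]
  | cons a l ih =>
    rw [List.forall_mem_cons] at h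
    rw [List.length_cons, pow_succ']
    calc c * c ^ l.length ≤ p a * iidSamples p l.length l := by
          gcongr
          exacts [h.1, ih h.2]
      _ ≤ p a * (iidSamples p l.length).map (fun l => a :: l) (a :: l) := by
          gcongr
          exact apply_le_map_apply _ (fun l => a :: l) l
      _ ≤ _ := mul_apply_le_bind_apply p _ a _

theorem iidSamples_notMem (p : PMF α) (a : α) (N : ℕ) :
    (iidSamples p N).toOuterMeasure {l | a ∉ l} ≤ (1 - p a) ^ N := by
  classical
  induction N with
  | zero =>
    rw [pow_zero, ← toOuterMeasure_add_compl (iidSamples p 0) {l | a ∉ l}]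
    exact le_self_add
  | succ N ih =>
    rw [iidSamples, PMF.toOuterMeasure_bind_apply, pow_succ']
    -- Condition on the first sample: it must differ from `a`, which contributes one factor `1 - p
    -- a`.
    have hp : (1 - p a) = ∑' b, if b = a then 0 else p b := by
      have := ENNReal.tsum_eq_add_tsum_ite (f := p) a
      rw [p.tsum_coe] at this
      rw [this, ENNReal.add_sub_cancel_left (p.apply_ne_top a)]
    rw [hp, ← ENNReal.tsum_mul_right]
    refine ENNReal.tsum_le_tsum fun b => ?_
    rw [PMF.toOuterMeasure_map_apply]
    by_cases hb : b = a
    · simp [hb]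
    · have : (fun l => b :: l) ⁻¹' {l : List α | a ∉ l} = {l | a ∉ l} := by
        ext l
        simp [Ne.symm hb]
      rw [this, if_neg hb, ← hp]
      gcongr

/-- From `1 - x ≤ e^(-x)` at `x = 1 / n ^ e`. This is where the factor `2` in the number of
candidates enters. -/
theorem one_sub_pow_le_exp_neg_two {q : ℝ≥0∞} {n e : ℕ} (hn : 1 ≤ n)
    (hq : (n : ℝ≥0∞)⁻¹ ^ e ≤ q) :
    (1 - q) ^ (2 * n ^ e) ≤ ENNReal.ofReal (Real.exp (-2)) := by
  have hM : (0 : ℝ) < n ^ e := by positivity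
  have h1 : 1 - q ≤ ENNReal.ofReal (Real.exp (-((n : ℝ) ^ e)⁻¹)) := by
    calc 1 - q ≤ 1 - (n : ℝ≥0∞)⁻¹ ^ e := by gcongr
      _ = ENNReal.ofReal (1 - ((n : ℝ) ^ e)⁻¹) := by
          rw [ENNReal.ofReal_sub _ (by positivity), ENNReal.ofReal_one,
            ENNReal.ofReal_inv_of_pos hM, ENNReal.ofReal_pow (by positivity),
            ENNReal.ofReal_natCast, ENNReal.inv_pow]
      _ ≤ _ := ENNReal.ofReal_le_ofReal (Real.one_sub_le_exp_neg _)
  refine (pow_le_pow_left' h1 _).trans (le_of_eq ?_)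
  rw [← ENNReal.ofReal_pow (Real.exp_nonneg _), ← Real.exp_nat_mul]
  congr 2
  push_cast
  field_simp

theorem uniformSize_apply {E : Type*} {X : Finset E} (hX : X.Nonempty) {b : ℕ}
    (hb : b ∈ Finset.Icc 1 X.card) : uniformSize X hX b = (X.card : ℝ≥0∞)⁻¹ := by
  rw [uniformSize, PMF.uniformOfFinset_apply_of_mem _ hb]
  simp

end Probability

open Classical in
theorem subset_of_mem_support_greedy {E : Type*} (select : Finset E → PMF (List E))
    (pick : ℕ → Finset E → List E → PMF E) (C₀ : Finset E) (t : ℕ) :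
    ∀ C ∈ (greedy select pick C₀ t).support, C₀ ⊆ C := by
  induction t with
  | zero => simp [greedy]
  | succ t ih =>
    intro C hC
    simp only [greedy, PMF.mem_support_bind_iff, PMF.mem_support_map_iff] at hC
    obtain ⟨D, hD, Y, -, c, -, rfl⟩ := hC
    exact (ih D hD).trans (Finset.subset_insert _ _)

/-! ### Excess cost and optimal clusters -/

section Potential

open scoped ENNReal

variable {E : Type*} [NormedAddCommGroup E]

/-- Some optimal cluster accounts for at least a `1 / k` fraction of the excess cost. -/
theorem exists_cluster (X Copt C : Finset E) (hC : Copt.Nonempty) (R : ℝ) :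
    ∃ A ⊆ X, ∃ c : E, cost X C - R * cost X Copt ≤
      Copt.card * (cost A C - R * cost A {c}) := by
  classical
  have hnear : ∀ x : E, ∃ c ∈ Copt, Metric.infDist x (Copt : Set E) = dist x c := fun x => by
    simpa using Copt.finite_toSet.isCompact.exists_infDist_eq_dist (by exact_mod_cast hC) x
  choose π hπ hdist using hnear
  -- Assign each point to a nearest optimal center; the excesses of these clusters sum to the total,
  -- so the largest is at least the average.
  obtain ⟨c, hc, hmax⟩ := Finset.exists_max_image Copt
    (fun c => cost (X.filter (π · = c)) C - R * cost (X.filter (π · = c)) {c}) hC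
  refine ⟨X.filter (π · = c), Finset.filter_subset _ _, c, ?_⟩
  rw [← nsmul_eq_mul]
  refine le_trans (le_of_eq ?_) (Finset.sum_le_card_nsmul Copt _ _ hmax)
  rw [Finset.sum_sub_distrib, ← Finset.mul_sum]
  congr 2
  · exact (Finset.sum_fiberwise_of_maps_to (fun x _ => hπ x) _).symm
  · rw [cost, ← Finset.sum_fiberwise_of_maps_to (fun x _ => hπ x)]
    refine Finset.sum_congr rfl fun j _ => ?_
    rw [cost_singleton]
    refine Finset.sum_congr rfl fun x hx => ?_
    rw [hdist, (Finset.mem_filter.mp hx).2]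

-- Serve `A` by `w` and leave all other points with their old centers.
open Classical in
theorem cost_insert_le {X A : Finset E} (hA : A ⊆ X) {C : Finset E} (hC : C.Nonempty) (w : E) :
    cost X (insert w C) ≤ cost X C - cost A C + cost A {w} := by
  have h (D : Finset E) : cost X D = cost (X \ A) D + cost A D :=
    (Finset.sum_sdiff hA).symm
  have h1 := cost_anti (X \ A) hC (Finset.subset_insert w C)
  have h2 := cost_anti A (Finset.singleton_nonempty w)
    (Finset.singleton_subset_iff.mpr (Finset.mem_insert_self w C))
  rw [h (insert w C), h C]
  linarith

/-- The `k`-th power of the excess cost over the benchmark `b`. -/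
noncomputable def potential (X : Finset E) (k : ℕ) (b : ℝ) (C : Finset E) : ℝ≥0∞ :=
  ENNReal.ofReal (max (cost X C - b) 0 ^ k)

theorem potential_anti (X : Finset E) (k : ℕ) (b : ℝ) {C D : Finset E} (hC : C.Nonempty)
    (h : C ⊆ D) : potential X k b D ≤ potential X k b C := by
  have := cost_anti X hC h
  unfold potential
  gcongr

end Potential

/-! ### Expected decrease of the potential per round -/

section Greedy

open scoped ENNReal

variable {E : Type*} [NormedAddCommGroup E] [InnerProductSpace ℝ E]

/-- Every outcome of the sampling has probability at least `n ^ (-(3 + s))`. -/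
theorem inv_pow_le_sgdCandidate_apply {X : Finset E} (hX : X.Nonempty)
    (near : E → ℕ → Finset E) (grad : E → E → E) (ε : ℝ) {y : E} (hy : y ∈ X) {b m : ℕ}
    (hb : b ∈ Finset.Icc 1 X.card) (hm : m ∈ Finset.Icc 1 X.card) {xs : List E}
    (hlen : xs.length = ⌈1 / ε ^ 2⌉₊) (hxs : ∀ x ∈ xs, x ∈ X) :
    (X.card : ℝ≥0∞)⁻¹ ^ (3 + ⌈1 / ε ^ 2⌉₊) ≤ sgdCandidate X hX near grad ε
      (average (sgdIterates grad (Metric.closedBall y (cost (near y b) {y} / m))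
        (2 * (cost (near y b) {y} / m) / √⌈1 / ε ^ 2⌉₊) y xs)) := by
  have hguess : (X.card : ℝ≥0∞)⁻¹ ^ 3 ≤ guessBall X hX near (y, m, near y b) := by
    rw [guessBall]
    refine le_trans ?_ (mul_apply_le_bind_apply _ _ y _)
    rw [PMF.uniformOfFinset_apply_of_mem _ hy, pow_succ']
    gcongr
    refine le_trans ?_ (mul_apply_le_bind_apply _ _ b _)
    rw [uniformSize_apply hX hb, pow_two]
    gcongr
    refine le_trans ?_ (apply_le_map_apply _ (fun m => (y, m, near y b)) m)
    rw [uniformSize_apply hX hm]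
  have hsamples : (X.card : ℝ≥0∞)⁻¹ ^ ⌈1 / ε ^ 2⌉₊ ≤
      iidSamples (PMF.uniformOfFinset X hX) ⌈1 / ε ^ 2⌉₊ xs := by
    rw [← hlen]
    exact pow_le_iidSamples_apply _ xs fun x hx =>
      (PMF.uniformOfFinset_apply_of_mem hX (hxs x hx)).ge
  rw [sgdCandidate, pow_add]
  refine le_trans ?_ (mul_apply_le_bind_apply _ _ (y, m, near y b) _)
  refine mul_le_mul' hguess (hsamples.trans ?_)
  exact apply_le_map_apply _ (fun xs => average (sgdIterates grad _ _ y xs)) xs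

open Classical in
/-- Some candidate of non-negligible probability reduces the excess cost by a `1 / k` fraction. -/
theorem exists_good_candidate [CompleteSpace E] {X : Finset E} (hX : X.Nonempty)
    {near : E → ℕ → Finset E} (hnear : IsClosestRule X near) {grad : E → E → E}
    (hgrad : IsSubgradientOracle X grad) {ε : ℝ} (hε : 0 < ε) {Copt C : Finset E}
    (hopt : Copt.Nonempty) (hC : C.Nonempty)
    (hgap : (1 + 16 * ε) * cost X Copt < cost X C) :
    ∃ w, (X.card : ℝ≥0∞)⁻¹ ^ (3 + ⌈1 / ε ^ 2⌉₊) ≤ sgdCandidate X hX near grad ε w ∧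
      cost X (insert w C) - (1 + 16 * ε) * cost X Copt ≤
        (1 - 1 / Copt.card) * (cost X C - (1 + 16 * ε) * cost X Copt) := by
  have hk : (0 : ℝ) < Copt.card := by exact_mod_cast hopt.card_pos
  obtain ⟨A, hAX, c, hA⟩ := exists_cluster X Copt C hopt (1 + 16 * ε)
  -- An empty cluster has zero excess, against the positive total.
  have hne : A.Nonempty := by
    rw [Finset.nonempty_iff_ne_empty]
    rintro rfl
    simp only [cost, Finset.sum_empty, mul_zero, sub_zero] at hA hgap
    linarith
  obtain ⟨y, hy, b, hb, m, hm, xs, hlen, hxs, hw⟩ :=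
    exists_good_outcome hnear hgrad hAX hne c hε (Nat.le_ceil (1 / ε ^ 2))
  refine ⟨_, inv_pow_le_sgdCandidate_apply hX near grad ε hy hb hm hlen hxs, ?_⟩
  refine (sub_le_sub_right (cost_insert_le hAX hC _) _).trans ?_
  rw [← div_le_iff₀' hk] at hA
  have : (1 - 1 / (Copt.card : ℝ)) * (cost X C - (1 + 16 * ε) * cost X Copt) =
      cost X C - (1 + 16 * ε) * cost X Copt -
        (cost X C - (1 + 16 * ε) * cost X Copt) / Copt.card := by ring
  rw [this]
  linarith

open Classical in
/-- The expected potential drops by a constant factor in each round. -/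
theorem expect_round_le [CompleteSpace E] {X : Finset E} (hX : X.Nonempty)
    {near : E → ℕ → Finset E} (hnear : IsClosestRule X near) {grad : E → E → E}
    (hgrad : IsSubgradientOracle X grad) {pick : ℕ → Finset E → List E → PMF E}
    (hpick : IsGreedyRule X pick) {ε : ℝ} (hε : 0 < ε) {Copt C : Finset E}
    (hopt : Copt.Nonempty) (hC : C.Nonempty) (i : ℕ) :
    expect ((selectSgd X hX near grad ε).bind fun Y => (pick i C Y).map fun c => insert c C)
        (potential X Copt.card ((1 + 16 * ε) * cost X Copt)) ≤
      ENNReal.ofReal (Real.exp (-(1 / 4))) *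
        potential X Copt.card ((1 + 16 * ε) * cost X Copt) C := by
  have hk : 1 ≤ Copt.card := hopt.card_pos
  have hk' : (1 : ℝ) ≤ Copt.card := by exact_mod_cast hk
  set b := (1 + 16 * ε) * cost X Copt with hb
  set F := potential X Copt.card b with hF
  simp only [expect_bind, expect_map]
  have hmono (c : E) : F (insert c C) ≤ F C :=
    potential_anti X _ _ hC (Finset.subset_insert c C)
  rcases le_or_gt (cost X C) b with hgap | hgap
  · have hzero : F C = 0 := by
      rw [hF, potential, max_eq_right (by linarith), zero_pow (by omega), ENNReal.ofReal_zero]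
    rw [hzero, mul_zero]
    refine (expect_mono fun Y _ => expect_mono fun c _ => hmono c).trans ?_
    simp only [hzero, expect_const, le_refl]
  obtain ⟨w, hw, hred⟩ := exists_good_candidate hX hnear hgrad hε hopt hC hgap
  rw [← hb] at hred
  -- If `w` is among the candidates, the greedy choice does at least as well as `w`; otherwise the
  -- potential at least does not grow.
  have hround : ∀ Y : List E, expect (pick i C Y) (fun c => F (insert c C)) ≤
      ENNReal.ofReal (Real.exp (-1)) * F C + {Y : List E | w ∉ Y}.indicator (fun _ => F C) Y := by
    intro Y
    by_cases hY : w ∈ Y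
    · refine le_trans (le_trans ?_ (expect_const (pick i C Y) _).le) le_self_add
      refine expect_mono fun c hc => ?_
      have hle := (hpick i C Y (List.ne_nil_of_mem hY) c hc).2 w hY
      rw [hF, potential, potential, ← ENNReal.ofReal_mul (Real.exp_nonneg _)]
      refine ENNReal.ofReal_le_ofReal ?_
      have hfac : (0 : ℝ) ≤ 1 - 1 / Copt.card := by
        rw [sub_nonneg, div_le_one (by linarith)]
        exact hk'
      calc max (cost X (insert c C) - b) 0 ^ Copt.card
          ≤ ((1 - 1 / (Copt.card : ℝ)) * max (cost X C - b) 0) ^ Copt.card := by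
            refine pow_le_pow_left₀ (le_max_right _ _) (max_le ?_ (by positivity)) _
            rw [max_eq_left (by linarith)]
            linarith
        _ = (1 - 1 / (Copt.card : ℝ)) ^ Copt.card * max (cost X C - b) 0 ^ Copt.card :=
            mul_pow _ _ _
        _ ≤ _ := by
            gcongr
            exact Real.one_sub_div_pow_le_exp_neg hk'
    · refine le_trans ?_ le_add_self
      rw [Set.indicator_of_mem (by exact hY)]
      exact (expect_mono fun c _ => hmono c).trans (expect_const _ _).le
  calc expect (selectSgd X hX near grad ε) (fun Y => expect (pick i C Y) fun c => F (insert c C))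
      ≤ ENNReal.ofReal (Real.exp (-1)) * F C +
          (selectSgd X hX near grad ε).toOuterMeasure {Y | w ∉ Y} * F C := by
        refine (expect_mono fun Y _ => hround Y).trans ?_
        rw [expect_add, expect_const, expect_indicator]
    _ ≤ ENNReal.ofReal (Real.exp (-1)) * F C + ENNReal.ofReal (Real.exp (-2)) * F C := by
        gcongr
        exact (iidSamples_notMem _ w _).trans (one_sub_pow_le_exp_neg_two hX.card_pos hw)
    _ ≤ _ := by
        rw [← add_mul, ← ENNReal.ofReal_add (Real.exp_nonneg _) (Real.exp_nonneg _)]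
        gcongr
        -- Numerically, `0.4 + 0.16 ≤ 3/4 ≤ e^(-1/4)`.
        have h1 : Real.exp (-1) ≤ 0.4 := by
          rw [Real.exp_neg]
          refine inv_le_of_inv_le₀ (by norm_num) ?_
          have := Real.exp_one_gt_d9
          norm_num
          linarith
        have h2 : Real.exp (-2) = Real.exp (-1) * Real.exp (-1) := by
          rw [← Real.exp_add]
          norm_num
        have h3 := Real.add_one_le_exp (-(1 / 4) : ℝ)
        have h4 := Real.exp_nonneg (-1)
        rw [h2]
        nlinarith

theorem expect_greedy_le [CompleteSpace E] {X : Finset E} (hX : X.Nonempty)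
    {near : E → ℕ → Finset E} (hnear : IsClosestRule X near) {grad : E → E → E}
    (hgrad : IsSubgradientOracle X grad) {pick : ℕ → Finset E → List E → PMF E}
    (hpick : IsGreedyRule X pick) {ε : ℝ} (hε : 0 < ε) {Copt C₀ : Finset E}
    (hopt : Copt.Nonempty) (hC₀ : C₀.Nonempty) (t : ℕ) :
    expect (greedy (fun _ => selectSgd X hX near grad ε) pick C₀ t)
        (potential X Copt.card ((1 + 16 * ε) * cost X Copt)) ≤
      ENNReal.ofReal (Real.exp (-(1 / 4))) ^ t *
        potential X Copt.card ((1 + 16 * ε) * cost X Copt) C₀ := by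
  induction t with
  | zero => simp [greedy, expect_pure]
  | succ t ih =>
    rw [greedy, expect_bind]
    refine (expect_mono fun C hC => expect_round_le hX hnear hgrad hpick hε hopt
      (hC₀.mono (subset_of_mem_support_greedy _ _ _ _ C hC)) (t + 1)).trans ?_
    rw [expect_mul_left, pow_succ', mul_assoc]
    gcongr

end Greedy

end EuclideanKMedians

/-! ### Markov's inequality and the number of rounds -/

theorem mainTheorem5 {d k : ℕ} (hk : 1 ≤ k)
    (X : Finset (EuclideanSpace ℝ (Fin d))) (hX : X.Nonempty)
    (Copt : Finset (EuclideanSpace ℝ (Fin d))) (hopt : EuclideanKMedians.IsOptimal X k Copt)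
    (near : EuclideanSpace ℝ (Fin d) → ℕ → Finset (EuclideanSpace ℝ (Fin d)))
    (hnear : EuclideanKMedians.IsClosestRule X near)
    (grad : EuclideanSpace ℝ (Fin d) → EuclideanSpace ℝ (Fin d) → EuclideanSpace ℝ (Fin d))
    (hgrad : EuclideanKMedians.IsSubgradientOracle X grad)
    (pick : ℕ → Finset (EuclideanSpace ℝ (Fin d)) → List (EuclideanSpace ℝ (Fin d)) →
      PMF (EuclideanSpace ℝ (Fin d)))
    (hpick : EuclideanKMedians.IsGreedyRule X pick)
    (ε δ α : ℝ) (hε : 0 < ε) (hδ : 0 < δ) (hα : 1 ≤ α)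
    (C₀ : Finset (EuclideanSpace ℝ (Fin d))) (hC₀ : C₀.Nonempty)
    (hinit : EuclideanKMedians.cost X C₀ ≤
      α * (1 + 16 * ε) * EuclideanKMedians.cost X Copt)
    (t : ℕ)
    (ht : 1 < α → 4 * k * Real.log ((α - 1) / ε) + 8 * Real.log (1 / δ) ≤ t) :
    ENNReal.ofReal (1 - δ) ≤
      (EuclideanKMedians.greedy
        (fun _ => EuclideanKMedians.selectSgd X hX near grad ε) pick C₀ t).toOuterMeasure
        {C | EuclideanKMedians.cost X C ≤
          (1 + ε) * (1 + 16 * ε) * EuclideanKMedians.cost X Copt} := by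
  open EuclideanKMedians in
  obtain ⟨rfl, -⟩ := hopt
  have hCopt : Copt.Nonempty := Finset.card_pos.mp hk
  set p := greedy (fun _ => selectSgd X hX near grad ε) pick C₀ t with hp
  set b := (1 + 16 * ε) * cost X Copt with hb
  have hb0 : 0 ≤ b := mul_nonneg (by positivity) (cost_nonneg _ _)
  rw [mul_assoc, ← hb] at hinit
  rw [mul_assoc, ← hb]
  rcases le_or_gt 1 δ with hδ1 | hδ1
  · rw [ENNReal.ofReal_of_nonpos (by linarith)]
    exact zero_le
  rcases le_or_gt (cost X C₀) ((1 + ε) * b) with hgood | hbad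
  · rw [(PMF.toOuterMeasure_apply_eq_one_iff p {C | cost X C ≤ (1 + ε) * b}).mpr fun C hC =>
      (cost_anti X hC₀ (subset_of_mem_support_greedy _ _ _ _ C hC)).trans hgood]
    exact ENNReal.ofReal_le_one.mpr (by linarith)
  have hbpos : 0 < b := hb0.lt_of_ne fun h => by
    rw [← h] at hinit hbad
    linarith
  -- A start above the target forces `α > 1 + ε`, so the bound on `t` is available.
  have hαε : ε < α - 1 := by
    have := lt_of_mul_lt_mul_right (hbad.trans_le hinit) hb0
    linarith
  have ht := ht (by linarith)
  -- Failure means an excess above `ε b`, hence a potential of at least `(ε b) ^ k`.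
  have hmarkov := (toOuterMeasure_mul_le_expect p (S := {C | cost X C ≤ (1 + ε) * b}ᶜ)
    (F := potential X Copt.card b) (c := ENNReal.ofReal ((ε * b) ^ Copt.card)) fun C hC => by
      rw [Set.mem_compl_iff, Set.mem_ofPred_eq, not_le] at hC
      refine ENNReal.ofReal_le_ofReal (pow_le_pow_left₀ (by positivity) (le_max_of_le_left ?_) _)
      linarith).trans (expect_greedy_le hX hnear hgrad hpick hε hCopt hC₀ t)
  have hfail : p.toOuterMeasure {C | cost X C ≤ (1 + ε) * b}ᶜ ≤ ENNReal.ofReal δ := by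
    have hpos : 0 < (ε * b) ^ Copt.card := by positivity
    rw [← ENNReal.mul_le_mul_iff_left (ENNReal.ofReal_pos.mpr hpos).ne' ENNReal.ofReal_ne_top]
    refine hmarkov.trans ?_
    rw [potential, ← ENNReal.ofReal_pow (Real.exp_nonneg _),
      ← ENNReal.ofReal_mul (by positivity), ← ENNReal.ofReal_mul hδ.le]
    refine ENNReal.ofReal_le_ofReal ?_
    have hL : Real.exp (Real.log ((α - 1) / ε)) = (α - 1) / ε :=
      Real.exp_log (div_pos (by linarith) hε)
    have hD : Real.exp (-Real.log (1 / δ)) = δ := by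
      rw [one_div, Real.log_inv, neg_neg, Real.exp_log hδ]
    have hDpos : 0 ≤ Real.log (1 / δ) := Real.log_nonneg (by rw [le_div_iff₀ hδ]; linarith)
    have hmax : max (cost X C₀ - b) 0 ≤ (α - 1) / ε * (ε * b) := by
      have : (α - 1) / ε * (ε * b) = (α - 1) * b := by field_simp
      rw [this]
      exact max_le (by linarith) (mul_nonneg (by linarith) hb0)
    calc Real.exp (-(1 / 4)) ^ t * max (cost X C₀ - b) 0 ^ Copt.card
        ≤ Real.exp (-(1 / 4)) ^ t * ((α - 1) / ε * (ε * b)) ^ Copt.card := by gcongr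
      _ = Real.exp (t * (-(1 / 4)) + Copt.card * Real.log ((α - 1) / ε)) *
            (ε * b) ^ Copt.card := by
          rw [mul_pow, Real.exp_add, Real.exp_nat_mul, Real.exp_nat_mul, hL, mul_assoc]
      _ ≤ δ * (ε * b) ^ Copt.card := by
          gcongr
          refine (Real.exp_le_exp.mpr ?_).trans hD.le
          -- The bound on `t` gives `t / 4 ≥ k ln((α - 1)/ε) + 2 ln(1/δ)`; one `ln(1/δ)`,
          -- nonnegative as `δ < 1`, suffices.
          linarith
  have hadd := toOuterMeasure_add_compl p {C | cost X C ≤ (1 + ε) * b}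
  rw [ENNReal.ofReal_sub _ hδ.le, ENNReal.ofReal_one, tsub_le_iff_right, ← hadd]
  gcongr
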